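/- Let $\lambda_0,\lambda_1,\mu,\theta_1,\mu_A\ge 0$ with $\lambda_0+\mu_A>0$, and let $(g_{0,i})_{i\ge1}$, $(g_{1,i})_{i\ge1}$, $(\pi_{2,i})_{i\ge1}$ be probability distributions on $\mathbb N^*=\{1,2,\dots\}$. Let $Y$ be a queue on $\mathbb N=\{0,1,\dots\}$, i.e. a Markov process whose infinitesimal generator has the entries $$Q_{m,m+k}=\lambda_1 g_{1,k}\ (k\ge1),\qquad Q_{m,m-1}=\mu+m\theta_1\ (m\ge1),\qquad Q_{0,0}=-\lambda_1,\qquad Q_{m,m}=-(\lambda_1+\mu+m\theta_1)\ (m\ge1),$$ all others being $0$, and let $p_{i,j}(t)=\mathbf P(1+Y(t)=j\mid 1+Y(0)=i)$ for $i,j\in\mathbb N^*$. The volume $X=(X(t))_{t\ge0}$ at the best quote is the following process on $\mathbb N^*$. Aggressive limit orders are submitted according to a Poisson process of rate $\lambda_0$, their sizes being i.i.d. with distribution $g_0$; aggressive market orders are submitted according to a Poisson process of rate $\mu_A$, and the volumes found at the next non-empty limit at those times are i.i.d. with distribution $\pi_2$ (for instance, the stationary distribution of the volume at the second limit). Each such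 order is a price move. At a price move $X$ is killed and instantly reset, to the size of the order if it is an aggressive limit order, and to the volume of the next non-empty limit if it is an aggressive market order. From time $0$ (with a random initial value $X(0)$) and from every price move on, until the next price move, $X$ follows a fresh path of $1+Y$ started at the (re)set value. The two Poisson processes, the sizes, the volumes, the initial value and the paths of $1+Y$ (one for each price move and each starting value) are independent. Put $$h_i=\frac{\lambda_0\, g_{0,i}}{\lambda_0+\mu_A}+\frac{\mu_A\,\pi_{2,i}}{\lambda_0+\mu_A},\qquad f_j(t)=\sum_{i\ge1}h_i\,p_{i,j}(t),\qquad \hat f_j(s)=\int_0^\infty e^{-st}f_j(t)\,dt .$$ Then the price moves form a Poisson process of rate $\lambda_0+\mu_A$; the series $f_j$ converge and their Laplace transforms exist at $\lambda_0+\mu_A$; and $$\pi_j=(\lambda_0+\mu_A)\,\hat f_j(\lambda_0+\mu_A),\qquad j\ge1,$$ is a probability distribution on $\mathbb N^*$ and is the unique stationary distribution of $X$: the law of $X(t)$ is the same for all $t\ge0$ if and only if $X(0)$ has distribution $\pi$. -/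

import Mathlib

open MeasureTheory ProbabilityTheory Set
open scoped NNReal ENNReal

namespace OrderBook

/-- The discrete σ-algebra on the positive integers. -/
instance instMeasurableSpacePNat : MeasurableSpace ℕ+ := ⊤

/-- Parameters of the Poisson model of one side of the book.
* `lam0`, `g0`: rate and size distribution of the aggressive limit orders;
* `lam1`, `g1`: rate and size distribution of the limit orders at the best quote;
* `mu`: rate of the unit-sized partial market orders;
* `theta1`: cancellation rate of each cancellable share at the best quote;
* `muA`: rate of the aggressive market orders;
* `pi2`: distribution of the volume found at the next non-empty limit. -/
structure Params where
  lam0 : ℝ≥0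
  lam1 : ℝ≥0
  mu : ℝ≥0
  theta1 : ℝ≥0
  muA : ℝ≥0
  g0 : PMF ℕ+
  g1 : PMF ℕ+
  pi2 : PMF ℕ+

/-- Rate at which the queue `Y` in state `m` loses one share; nothing is lost in state `0`. -/
def Params.downRate (B : Params) (m : ℕ) : ℝ :=
  if m = 0 then 0 else B.mu + m * B.theta1

/-- Infinitesimal generator of the queue `Y` (the volume at the best quote minus one, when the
price does not move). -/
noncomputable def Params.generator (B : Params) (m n : ℕ) : ℝ :=
  if n = m then -(B.lam1 + B.downRate m)
  else if h : m < n then B.lam1 * (B.g1 ⟨n - m, Nat.sub_pos_of_lt h⟩).toReal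
  else if n + 1 = m then B.downRate m
  else 0

/-- `r` is the (stochastic, standard) transition function of a Markov process on `ℕ` with
infinitesimal generator `Q`. -/
structure IsTransitionFunction (Q : ℕ → ℕ → ℝ) (r : ℝ≥0 → ℕ → ℕ → ℝ) : Prop where
  nonneg : ∀ t m n, 0 ≤ r t m n
  hasSum_one : ∀ t m, HasSum (fun n => r t m n) 1
  zero : ∀ m n, r 0 m n = if m = n then 1 else 0
  add : ∀ s t m n, HasSum (fun k => r s m k * r t k n) (r (s + t) m n)
  hasDerivWithinAt : ∀ m n,
    HasDerivWithinAt (fun t : ℝ => r t.toNNReal m n) (Q m n) (Ici 0) 0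

/-- `Y` is a right-continuous Markov process on `ℕ` started at `m`, with transition
function `r`. -/
structure IsMarkovFrom {Ω : Type*} [MeasurableSpace Ω] (r : ℝ≥0 → ℕ → ℕ → ℝ) (m : ℕ)
    (Y : ℝ≥0 → Ω → ℕ) (P : Measure Ω) : Prop where
  measurable : ∀ t, Measurable (Y t)
  rightCts : ∀ ω t, ContinuousWithinAt (fun s => Y s ω) (Ici t) t
  fdd : ∀ (n : ℕ) (t : Fin (n + 1) → ℝ≥0) (x : Fin (n + 1) → ℕ), Monotone t →
    P.real {ω | ∀ k, Y (t k) ω = x k} =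
      r (t 0) m (x 0) *
        ∏ k : Fin n, r (t k.succ - t k.castSucc) (x k.castSucc) (x k.succ)

/-- `N` is (the counting process of) a Poisson process with rate `a`. -/
structure IsPoissonProcess {Ω : Type*} [MeasurableSpace Ω] (a : ℝ≥0) (N : ℝ≥0 → Ω → ℕ)
    (P : Measure Ω) : Prop where
  measurable : ∀ t, Measurable (N t)
  zero : ∀ ω, N 0 ω = 0
  mono : ∀ ω, Monotone fun t => N t ω
  rightCts : ∀ ω t, ContinuousWithinAt (fun s => N s ω) (Ici t) t
  indepIncrements : HasIndepIncrements N P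
  law : ∀ s t, s ≤ t → P.map (fun ω => N t ω - N s ω) = poissonMeasure (a * (t - s))

/-- The random inputs of the model.
* `initial`: the volume at time `0`;
* `limitClock`, `marketClock`: the numbers of aggressive limit orders, respectively aggressive
  market orders, submitted up to time `t`;
* `limitSize k`: the size of the `k`-th aggressive limit order, `k ≥ 1`;
* `nextVolume k`: the volume of the next non-empty limit at the time of the `k`-th aggressive
  market order, `k ≥ 1`;
* `queue n m`: the path of the queue `Y` followed after the `n`-th price move (`n = 0`: from time
  `0`) if the queue is then reset to `m`. -/
structure Inputs (Ω : Type*) where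
  initial : Ω → ℕ+
  limitClock : ℝ≥0 → Ω → ℕ
  marketClock : ℝ≥0 → Ω → ℕ
  limitSize : ℕ → Ω → ℕ+
  nextVolume : ℕ → Ω → ℕ+
  queue : ℕ → ℕ → ℝ≥0 → Ω → ℕ

/-- Labels of the independent random inputs. -/
inductive InputLabel
  | initial
  | limitClock
  | marketClock
  | limitSize (k : ℕ)
  | nextVolume (k : ℕ)
  | queue (n m : ℕ)

/-- The σ-algebra generated by each random input. -/
@[reducible]
def Inputs.sigma {Ω : Type*} (D : Inputs Ω) : InputLabel → MeasurableSpace Ω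
  | .initial => MeasurableSpace.comap D.initial inferInstance
  | .limitClock => ⨆ t, MeasurableSpace.comap (D.limitClock t) inferInstance
  | .marketClock => ⨆ t, MeasurableSpace.comap (D.marketClock t) inferInstance
  | .limitSize k => MeasurableSpace.comap (D.limitSize k) inferInstance
  | .nextVolume k => MeasurableSpace.comap (D.nextVolume k) inferInstance
  | .queue n m => ⨆ t, MeasurableSpace.comap (D.queue n m t) inferInstance

/-- The random inputs `D` have the laws prescribed by the model with parameters `B`, where `r` is
the transition function of the queue `Y`. The law of the initial volume is free. -/
structure Inputs.IsModel {Ω : Type*} [MeasurableSpace Ω] (D : Inputs Ω) (B : Params)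
    (r : ℝ≥0 → ℕ → ℕ → ℝ) (P : Measure Ω) : Prop where
  measurable_initial : Measurable D.initial
  limitClock : IsPoissonProcess B.lam0 D.limitClock P
  marketClock : IsPoissonProcess B.muA D.marketClock P
  measurable_limitSize : ∀ k, Measurable (D.limitSize k)
  limitSize : ∀ k i, P {ω | D.limitSize k ω = i} = B.g0 i
  measurable_nextVolume : ∀ k, Measurable (D.nextVolume k)
  nextVolume : ∀ k i, P {ω | D.nextVolume k ω = i} = B.pi2 i
  queue : ∀ n m, IsMarkovFrom r m (D.queue n m) P
  indep : iIndep D.sigma P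

/-- The number of price moves up to time `t`. -/
def Inputs.priceMoves {Ω : Type*} (D : Inputs Ω) (t : ℝ≥0) (ω : Ω) : ℕ :=
  D.limitClock t ω + D.marketClock t ω

/-- The time of the last jump of the counting process `N` up to time `t` (`0` if there is none),
i.e. the first time at which `N` has reached its value at time `t`. -/
noncomputable def lastArrival {Ω : Type*} (N : ℝ≥0 → Ω → ℕ) (t : ℝ≥0) (ω : Ω) : ℝ≥0 :=
  sInf {s | N t ω ≤ N s ω}

/-- The volume to which the best quote was reset at the last price move up to time `t`: the size
of the order if that move is due to an aggressive limit order, the volume of the next non-empty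
limit if it is due to an aggressive market order, and the initial volume if there was no price
move. -/
noncomputable def Inputs.resetVolume {Ω : Type*} (D : Inputs Ω) (t : ℝ≥0) (ω : Ω) : ℕ+ :=
  if D.priceMoves t ω = 0 then D.initial ω
  else if lastArrival D.marketClock t ω < lastArrival D.limitClock t ω then
    D.limitSize (D.limitClock t ω) ω
  else D.nextVolume (D.marketClock t ω) ω

/-- The volume `X(t)` at the best quote: from the last price move on, it has followed a fresh path
of `1 + Y` started at the reset volume. -/
noncomputable def Inputs.volume {Ω : Type*} (D : Inputs Ω) (t : ℝ≥0) (ω : Ω) : ℕ+ :=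
  (D.queue (D.priceMoves t ω) (D.resetVolume t ω).natPred
    (t - lastArrival D.priceMoves t ω) ω).succPNat

/-- The transition probabilities `p_{i,j}(t)` of `1 + Y`, those of `Y` being `r`. -/
def shiftedTransition (r : ℝ≥0 → ℕ → ℕ → ℝ) (t : ℝ≥0) (i j : ℕ+) : ℝ :=
  r t i.natPred j.natPred

/-- The mixture `h`. -/
noncomputable def Params.h (B : Params) (i : ℕ+) : ℝ :=
  B.lam0 * (B.g0 i).toReal / (B.lam0 + B.muA) + B.muA * (B.pi2 i).toReal / (B.lam0 + B.muA)

/-- The series `f_j(t) = ∑_i h_i p_{i,j}(t)`. -/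
noncomputable def Params.f (B : Params) (r : ℝ≥0 → ℕ → ℕ → ℝ) (j : ℕ+) (t : ℝ) : ℝ :=
  ∑' i : ℕ+, B.h i * shiftedTransition r t.toNNReal i j

/-- The Laplace transform at `s` of a function on `(0, ∞)`. -/
noncomputable def laplace (f : ℝ → ℝ) (s : ℝ) : ℝ :=
  ∫ t in Ioi (0 : ℝ), Real.exp (-(s * t)) * f t

/-- `π_j = (λ₀ + μ_A) f̂_j(λ₀ + μ_A)`. -/
noncomputable def Params.stationary (B : Params) (r : ℝ≥0 → ℕ → ℕ → ℝ) (j : ℕ+) : ℝ :=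
  (B.lam0 + B.muA) * laplace (B.f r j) (B.lam0 + B.muA)

end OrderBook

/-! Write `c = λ₀ + μ_A` and let `ν` be the law of `X(0)`. At time `t` the volume is a fresh path of
`1 + Y` whose age is the time since the last price move, or `t` if there was none. The whole proof
rests on the one-dimensional formula `P(X(t) = j) = e^{-ct} (ν p(t))_j + ∫_0^t c e^{-cu} f_j(u) du`.
The first term is the event of no move. In the second, the last move is an aggressive limit order of
age `u` with density `λ₀ e^{-cu}`: a limit order occurred at that age, and no market order since.
The market case has density `μ_A e^{-cu}`. Since `λ₀ g₀ + μ_A π₂ = c h`, the two cases merge.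

Uniqueness: as `t → ∞` the first term vanishes and the integral tends to `π_j`, whatever `ν` is, so
a constant law must be `π`. Invariance: if `ν = π`, Chapman-Kolmogorov and a shift by `t` turn the
first term into `∫_t^∞ c e^{-cu} f_j(u) du`, exactly the missing tail.

The formula is `measure_volume_eq`. It comes from freezing the clocks by independence
(`measure_volume_eq_lintegral`) and from the age law (`lintegral_age_of_last`). The two directions
are carried by `tendsto_measure_volume` and `lintegral_Ici_moveDensity`. Sums and integrals are
computed in `ℝ≥0∞`, where they may be exchanged freely. -/

namespace OrderBook

open Filter Topology

/-- The history of a process. -/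
abbrev history {Ω α : Type*} [MeasurableSpace α] (N : ℝ≥0 → Ω → α) : MeasurableSpace Ω :=
  ⨆ t, MeasurableSpace.comap (N t) inferInstance

theorem measurable_history {Ω α : Type*} [MeasurableSpace α] (N : ℝ≥0 → Ω → α) (t : ℝ≥0) :
    Measurable[history N] (N t) :=
  (comap_measurable (N t)).mono (le_iSup (fun t => MeasurableSpace.comap (N t) inferInstance) t)
    le_rfl

/-! ### Superposition of Poisson processes and last arrival times -/

section Poisson

variable {Ω : Type*} [MeasurableSpace Ω] {P : Measure Ω}

/-- Two independent families of independent variables give a family of independent pairs. -/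
theorem iIndepFun_prodMk_of_indepFun [IsProbabilityMeasure P] {ι α β : Type*} [Fintype ι]
    [MeasurableSpace α] [MeasurableSpace β] {U : ι → Ω → α} {V : ι → Ω → β}
    (hU : ∀ i, Measurable (U i)) (hV : ∀ i, Measurable (V i))
    (iU : iIndepFun U P) (iV : iIndepFun V P)
    (h : IndepFun (fun ω i => U i ω) (fun ω i => V i ω) P) :
    iIndepFun (fun i ω => (U i ω, V i ω)) P := by
  have hU' : Measurable fun ω i => U i ω := measurable_pi_lambda _ hU
  have hV' : Measurable fun ω i => V i ω := measurable_pi_lambda _ hV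
  have hUV : ∀ i, Measurable fun ω => (U i ω, V i ω) := fun i => (hU i).prodMk (hV i)
  have : ∀ i, IsProbabilityMeasure (P.map (U i)) := fun i =>
    Measure.isProbabilityMeasure_map (hU i).aemeasurable
  have : ∀ i, IsProbabilityMeasure (P.map (V i)) := fun i =>
    Measure.isProbabilityMeasure_map (hV i).aemeasurable
  rw [iIndepFun_iff_map_fun_eq_pi_map fun i => (hUV i).aemeasurable]
  have hpair : ∀ i, P.map (fun ω => (U i ω, V i ω)) = (P.map (U i)).prod (P.map (V i)) := fun i =>
    (indepFun_iff_map_prod_eq_prod_map_map (hU i).aemeasurable (hV i).aemeasurable).1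
      (h.comp (measurable_pi_apply i) (measurable_pi_apply i))
  simp_rw [hpair]
  -- Regrouping a family of pairs as a pair of families is a measurable equivalence carrying the
  -- product of products to the product of the two product laws, so the joint laws may be compared
  -- after it.
  have hmp := measurePreserving_arrowProdEquivProdArrow α β ι
    (fun i => P.map (U i)) (fun i => P.map (V i))
  rw [← MeasurableEquiv.map_measurableEquiv_injective
    (MeasurableEquiv.arrowProdEquivProdArrow α β ι) |>.eq_iff, hmp.map_eq,
    Measure.map_map (MeasurableEquiv.measurable _) (measurable_pi_lambda _ hUV)]
  rw [← iU.map_fun_eq_pi_map fun i => (hU i).aemeasurable,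
    ← iV.map_fun_eq_pi_map fun i => (hV i).aemeasurable,
    ← (indepFun_iff_map_prod_eq_prod_map_map hU'.aemeasurable hV'.aemeasurable).1 h]
  rfl

theorem indepFun_of_indep {α β : Type*} [MeasurableSpace α] [MeasurableSpace β]
    {m₁ m₂ : MeasurableSpace Ω} (h : Indep m₁ m₂ P) {X : Ω → α} {Y : Ω → β}
    (hX : Measurable[m₁] X) (hY : Measurable[m₂] Y) : IndepFun X Y P :=
  (IndepFun_iff_Indep _ _ _).2 (indep_of_indep_of_le h hX.comap_le hY.comap_le)

theorem history_le {α : Type*} [MeasurableSpace α] {N : ℝ≥0 → Ω → α}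
    (h : ∀ t, Measurable (N t)) : history N ≤ ‹MeasurableSpace Ω› :=
  iSup_le fun t => (h t).comap_le

/-- The superposition of two independent Poisson processes is a Poisson process. -/
theorem IsPoissonProcess.add [IsProbabilityMeasure P] {a b : ℝ≥0} {L M : ℝ≥0 → Ω → ℕ}
    (hL : IsPoissonProcess a L P) (hM : IsPoissonProcess b M P)
    (h : Indep (history L) (history M) P) :
    IsPoissonProcess (a + b) (fun t ω => L t ω + M t ω) P where
  measurable t := (hL.measurable t).add (hM.measurable t)
  zero ω := by simp [hL.zero, hM.zero]
  mono ω := (hL.mono ω).add (hM.mono ω)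
  rightCts ω t := (hL.rightCts ω t).add (hM.rightCts ω t)
  indepIncrements n t ht := by
    have key := iIndepFun_prodMk_of_indepFun
      (fun i => (hL.measurable (t (Fin.succ i))).sub (hL.measurable (t i.castSucc)))
      (fun i => (hM.measurable (t (Fin.succ i))).sub (hM.measurable (t i.castSucc)))
      (hL.indepIncrements n t ht) (hM.indepIncrements n t ht)
      (indepFun_of_indep h
        (@measurable_pi_lambda _ _ _ (history L) _ _ fun i =>
          (measurable_history L (t (Fin.succ i))).sub (measurable_history L (t i.castSucc)))
        (@measurable_pi_lambda _ _ _ (history M) _ _ fun i =>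
          (measurable_history M (t (Fin.succ i))).sub (measurable_history M (t i.castSucc))))
    refine (key.comp (fun _ p => p.1 + p.2) fun _ => measurable_fst.add measurable_snd).congr
      fun i => .of_forall fun ω => ?_
    -- Subtraction in `ℕ` is truncated; monotonicity of both processes makes the increments add.
    have h1 := hL.mono ω (ht (Fin.castSucc_lt_succ (i := i)).le)
    have h2 := hM.mono ω (ht (Fin.castSucc_lt_succ (i := i)).le)
    simp only [Function.comp_apply, Pi.sub_apply] at h1 h2 ⊢
    omega
  law s t hst := by
    have hi : IndepFun (fun ω => L t ω - L s ω) (fun ω => M t ω - M s ω) P :=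
      indepFun_of_indep h ((measurable_history L t).sub (measurable_history L s))
        ((measurable_history M t).sub (measurable_history M s))
    have key := hi.hasLaw_add_poissonMeasure
      ⟨((hL.measurable t).sub (hL.measurable s)).aemeasurable, hL.law s t hst⟩
      ⟨((hM.measurable t).sub (hM.measurable s)).aemeasurable, hM.law s t hst⟩
    rw [add_mul, ← key.map_eq]
    congr 1
    ext ω
    have h1 := hL.mono ω hst
    have h2 := hM.mono ω hst
    simp only [Pi.add_apply] at h1 h2 ⊢
    omega

/-- The last arrival is the first time at which the present value is reached. -/
theorem IsPoissonProcess.lastArrival_le_iff {a : ℝ≥0} {N : ℝ≥0 → Ω → ℕ}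
    (hN : IsPoissonProcess a N P) {s t : ℝ≥0} {ω : Ω} :
    lastArrival N t ω ≤ s ↔ N t ω ≤ N s ω := by
  refine ⟨fun h => ?_, fun h => csInf_le (OrderBot.bddBelow _) h⟩
  by_contra! hlt
  -- By right-continuity and discreteness, `N` keeps its value at `s` on some `[s, v)`. If that
  -- value is below `N t ω`, the level is not reached before `v > s`.
  have hev : ∀ᶠ u in 𝓝[≥] s, N u ω = N s ω :=
    (hN.rightCts ω s) (by simp : {N s ω} ∈ 𝓝 (N s ω))
  obtain ⟨v, hv, hv'⟩ := (mem_nhdsGE_iff_exists_Ico_subset).1 hev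
  have : v ≤ lastArrival N t ω := by
    refine le_csInf ⟨t, le_refl (N t ω)⟩ fun u hu => ?_
    by_contra! huv
    have h1 : N u ω ≤ N s ω := by
      rcases le_total u s with h' | h'
      · exact hN.mono ω h'
      · exact (hv' ⟨h', huv⟩ : N u ω = N s ω).le
    exact absurd (le_trans hu h1) (not_le.2 hlt)
  exact absurd (this.trans h) (not_le.2 hv)

theorem IsPoissonProcess.lastArrival_le {a : ℝ≥0} {N : ℝ≥0 → Ω → ℕ}
    (hN : IsPoissonProcess a N P) (t : ℝ≥0) (ω : Ω) : lastArrival N t ω ≤ t :=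
  hN.lastArrival_le_iff.2 le_rfl

theorem IsPoissonProcess.lastArrival_eq_zero_iff {a : ℝ≥0} {N : ℝ≥0 → Ω → ℕ}
    (hN : IsPoissonProcess a N P) {t : ℝ≥0} {ω : Ω} :
    lastArrival N t ω = 0 ↔ N t ω = 0 := by
  rw [← nonpos_iff_eq_zero, hN.lastArrival_le_iff, hN.zero, nonpos_iff_eq_zero]

theorem IsPoissonProcess.measurable_lastArrival {a : ℝ≥0} {N : ℝ≥0 → Ω → ℕ}
    (hN : IsPoissonProcess a N P) (t : ℝ≥0) : Measurable[history N] (lastArrival N t) := by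
  refine @measurable_of_Iic _ _ _ _ _ (history N) _ _ _ _ fun s => ?_
  have : lastArrival N t ⁻¹' Iic s = {ω | N t ω ≤ N s ω} := by
    ext ω; exact hN.lastArrival_le_iff
  rw [this]
  exact measurableSet_le (measurable_history N t) (measurable_history N s)

/-- The last arrival of a sum of counting processes is the latest of their last arrivals. -/
theorem IsPoissonProcess.lastArrival_add {a b c : ℝ≥0} {L M : ℝ≥0 → Ω → ℕ}
    (hL : IsPoissonProcess a L P) (hM : IsPoissonProcess b M P)
    (hN : IsPoissonProcess c (fun t ω => L t ω + M t ω) P) (t : ℝ≥0) (ω : Ω) :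
    lastArrival (fun t ω => L t ω + M t ω) t ω =
      max (lastArrival L t ω) (lastArrival M t ω) := by
  refine eq_of_forall_ge_iff fun s => ?_
  rw [max_le_iff, hL.lastArrival_le_iff, hM.lastArrival_le_iff, hN.lastArrival_le_iff]
  rcases le_total s t with h | h
  · have h1 := hL.mono ω h
    have h2 := hM.mono ω h
    simp only at h1 h2
    omega
  · have h1 := hL.mono ω h
    have h2 := hM.mono ω h
    simp only at h1 h2
    omega

/-- The event says that the increment over `(s, t]` vanishes, so this is a Poisson probability of
zero. -/
theorem IsPoissonProcess.measure_lastArrival_le {a : ℝ≥0} {N : ℝ≥0 → Ω → ℕ}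
    (hN : IsPoissonProcess a N P) {s t : ℝ≥0} (hst : s ≤ t) :
    P {ω | lastArrival N t ω ≤ s} = ENNReal.ofReal (Real.exp (-(a * ((t : ℝ) - s)))) := by
  have : {ω | lastArrival N t ω ≤ s} = (fun ω => N t ω - N s ω) ⁻¹' {0} := by
    ext ω
    simp [hN.lastArrival_le_iff, Nat.sub_eq_zero_iff_le]
  have hm : Measurable fun ω => N t ω - N s ω := (hN.measurable t).sub (hN.measurable s)
  rw [this, ← Measure.map_apply hm (measurableSet_singleton _), hN.law s t hst, poissonMeasure_singleton]
  simp [NNReal.coe_sub hst]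

end Poisson

/-! ### Law of the time since the last arrival -/

section Age

variable {Ω : Type*} [MeasurableSpace Ω] {P : Measure Ω}

theorem lintegral_Ico_exp (a : ℝ≥0) {x t : ℝ} (h : x ≤ t) :
    ∫⁻ u in Ico x t, ENNReal.ofReal (a * Real.exp (-(a * u))) =
      ENNReal.ofReal (Real.exp (-(a * x)) - Real.exp (-(a * t))) := by
  have hd : ∀ u : ℝ, HasDerivAt (fun u : ℝ => -Real.exp (-(a * u))) (a * Real.exp (-(a * u))) u :=
    fun u => by
      have := (((hasDerivAt_id u).const_mul (a : ℝ)).neg.exp).neg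
      refine this.congr_deriv ?_
      simp [mul_comm]
  have hc : Continuous fun u : ℝ => (a : ℝ) * Real.exp (-(a * u)) := by fun_prop
  rw [← ofReal_integral_eq_lintegral_ofReal
      ((hc.continuousOn.integrableOn_Icc (a := x) (b := t)).mono_set Ico_subset_Icc_self)
      (.of_forall fun u => by positivity),
    integral_Ico_eq_integral_Ioo, ← integral_Ioc_eq_integral_Ioo,
    ← intervalIntegral.integral_of_le h,
    intervalIntegral.integral_eq_sub_of_hasDerivAt (fun u _ => hd u) (hc.intervalIntegrable _ _)]
  congr 1
  ring

/-- The law of the time elapsed since the last arrival, on the event that there is one. -/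
theorem IsPoissonProcess.map_age [IsProbabilityMeasure P] {a : ℝ≥0} {N : ℝ≥0 → Ω → ℕ}
    (hN : IsPoissonProcess a N P) (t : ℝ≥0) :
    (P.restrict {ω | 0 < lastArrival N t ω}).map (fun ω => (t : ℝ) - lastArrival N t ω) =
      (volume.restrict (Ico (0 : ℝ) t)).withDensity
        fun u => ENNReal.ofReal (a * Real.exp (-(a * u))) := by
  have hA : Measurable (lastArrival N t) :=
    (hN.measurable_lastArrival t).mono (history_le hN.measurable) le_rfl
  have hA' : Measurable fun ω => (t : ℝ) - lastArrival N t ω := by fun_prop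
  refine Measure.ext_of_Ici _ _ fun x => ?_
  rw [Measure.map_apply hA' measurableSet_Ici, Measure.restrict_apply (hA' measurableSet_Ici),
    withDensity_apply _ measurableSet_Ici, Measure.restrict_restrict measurableSet_Ici]
  rcases lt_or_ge (t : ℝ) x with hx | hx
  · have h1 : (fun ω => (t : ℝ) - lastArrival N t ω) ⁻¹' Ici x ∩ {ω | 0 < lastArrival N t ω} = ∅ := by
      ext ω
      simp only [mem_inter_iff, mem_preimage, mem_Ici, mem_ofPred_eq, mem_empty_iff_false, iff_false]
      rintro ⟨h, -⟩
      have := (lastArrival N t ω).coe_nonneg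
      linarith
    have h2 : Ici x ∩ Ico (0 : ℝ) t = ∅ := by
      ext u
      simp only [mem_inter_iff, mem_Ici, mem_Ico, mem_empty_iff_false, iff_false]
      rintro ⟨h, -, h'⟩
      linarith
    rw [h1, h2]
    simp
  -- Ages are nonnegative, so a negative threshold `x` may be replaced by `0`.
  · set y : ℝ≥0 := x.toNNReal with hy
    have hyt : y ≤ t := Real.toNNReal_le_iff_le_coe.2 hx
    have h2 : Ici x ∩ Ico (0 : ℝ) t = Ico (y : ℝ) t := by
      ext u
      simp [hy, and_assoc]
    -- Age at least `y` means no arrival in the last `y` units of time; removing the event of no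
    -- arrival at all leaves mass `e^{-ay} - e^{-at}`.
    have h1 : (fun ω => (t : ℝ) - lastArrival N t ω) ⁻¹' Ici x ∩ {ω | 0 < lastArrival N t ω} =
        {ω | lastArrival N t ω ≤ t - y} \ {ω | lastArrival N t ω ≤ 0} := by
      ext ω
      simp only [mem_inter_iff, mem_preimage, mem_Ici, mem_ofPred_eq, Set.mem_sdiff, not_le]
      refine and_congr_left fun _ => ?_
      rw [← NNReal.coe_le_coe, NNReal.coe_sub hyt, hy, Real.coe_toNNReal']
      have h3 : (lastArrival N t ω : ℝ) ≤ t := hN.lastArrival_le t ω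
      rw [le_sub_comm (a := (lastArrival N t ω : ℝ)), max_le_iff]
      exact ⟨fun h => ⟨h, by linarith⟩, fun h => h.1⟩
    rw [h1, h2, lintegral_Ico_exp a (by exact_mod_cast hyt),
      measure_sdiff (s₁ := {ω | lastArrival N t ω ≤ t - y}) (s₂ := {ω | lastArrival N t ω ≤ 0})
        (fun ω (h : lastArrival N t ω ≤ 0) => (h.trans zero_le : lastArrival N t ω ≤ t - y))
        (measurableSet_le hA measurable_const).nullMeasurableSet (measure_ne_top _ _),
      hN.measure_lastArrival_le tsub_le_self, hN.measure_lastArrival_le zero_le,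
      ← ENNReal.ofReal_sub _ (Real.exp_pos _).le, NNReal.coe_sub hyt]
    simp

theorem IsPoissonProcess.lintegral_age [IsProbabilityMeasure P] {a : ℝ≥0} {N : ℝ≥0 → Ω → ℕ}
    (hN : IsPoissonProcess a N P) (t : ℝ≥0) {g : ℝ → ℝ≥0∞} (hg : Measurable g) :
    ∫⁻ ω in {ω | 0 < lastArrival N t ω}, g (t - lastArrival N t ω) ∂P =
      ∫⁻ u in Ico (0 : ℝ) t, ENNReal.ofReal (a * Real.exp (-(a * u))) * g u := by
  have hA : Measurable (lastArrival N t) :=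
    (hN.measurable_lastArrival t).mono (history_le hN.measurable) le_rfl
  have hA' : Measurable fun ω => (t : ℝ) - lastArrival N t ω := by fun_prop
  rw [← lintegral_map hg hA', hN.map_age, lintegral_withDensity_eq_lintegral_mul _ (by fun_prop) hg]
  rfl

/-- The age has a density on the event of a positive last arrival, hence no atom there. The atom at
`0`, where no arrival occurred, is why `0 < s` is needed. -/
theorem IsPoissonProcess.measure_lastArrival_eq [IsProbabilityMeasure P] {a : ℝ≥0}
    {N : ℝ≥0 → Ω → ℕ} (hN : IsPoissonProcess a N P) {s : ℝ≥0} (t : ℝ≥0) (hs : 0 < s) :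
    P {ω | lastArrival N t ω = s} = 0 := by
  have hA : Measurable (lastArrival N t) :=
    (hN.measurable_lastArrival t).mono (history_le hN.measurable) le_rfl
  have hA' : Measurable fun ω => (t : ℝ) - lastArrival N t ω := by fun_prop
  have h := congrArg (fun μ => μ {(t : ℝ) - s}) (hN.map_age t)
  simp only [measure_singleton] at h
  rw [Measure.map_apply hA' (measurableSet_singleton _),
    Measure.restrict_apply (hA' (measurableSet_singleton _))] at h
  rw [← h]
  congr 1
  ext ω
  simp only [mem_ofPred_eq, mem_inter_iff, mem_preimage, mem_singleton_iff, sub_right_inj,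
    NNReal.coe_inj]
  exact ⟨fun h => ⟨h, h ▸ hs⟩, fun h => h.1⟩

/-- Law of the age at time `t` of the superposition of two independent Poisson processes, on the
event that the last arrival is one of the first process. The relation `R` tells how ties are
broken. -/
theorem lintegral_age_of_last [IsProbabilityMeasure P] {a b : ℝ≥0} {L M : ℝ≥0 → Ω → ℕ}
    (hL : IsPoissonProcess a L P) (hM : IsPoissonProcess b M P)
    (h : Indep (history L) (history M) P) (t : ℝ≥0) {g : ℝ → ℝ≥0∞} (hg : Measurable g)
    {R : ℝ≥0 → ℝ≥0 → Prop} (hR : MeasurableSet {p : ℝ≥0 × ℝ≥0 | R p.1 p.2})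
    (hlt : ∀ x y, x < y → R x y) (hle : ∀ x y, R x y → x ≤ y) :
    ∫⁻ ω in {ω | 0 < lastArrival L t ω ∧ R (lastArrival M t ω) (lastArrival L t ω)},
        g (t - lastArrival L t ω) ∂P =
      ∫⁻ u in Ico (0 : ℝ) t, ENNReal.ofReal (a * Real.exp (-((a + b) * u))) * g u := by
  set A := lastArrival L t with hAdef
  set C := lastArrival M t with hCdef
  have hA : Measurable A := (hL.measurable_lastArrival t).mono (history_le hL.measurable) le_rfl
  have hC : Measurable C := (hM.measurable_lastArrival t).mono (history_le hM.measurable) le_rfl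
  have hAC : IndepFun A C P :=
    indepFun_of_indep h (hL.measurable_lastArrival t) (hM.measurable_lastArrival t)
  have hset : MeasurableSet {p : ℝ≥0 × ℝ≥0 | 0 < p.1 ∧ R p.2 p.1} :=
    (measurableSet_lt measurable_const measurable_fst).inter (measurable_swap hR)
  have hinner : ∀ s : ℝ≥0, 0 < s → s ≤ t →
      P {ω | R (C ω) s} = ENNReal.ofReal (Real.exp (-(b * ((t : ℝ) - s)))) := by
    intro s hs hst
    rw [← hM.measure_lastArrival_le hst]
    -- A tie at a positive time is a null event, so every rule between `<` and `≤` gives the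
    -- probability of no arrival of `M` in `(s, t]`.
    have hae : ∀ᵐ ω ∂P, C ω ≠ s := measure_eq_zero_iff_ae_notMem.1 (hM.measure_lastArrival_eq t hs)
    refine measure_congr ?_
    filter_upwards [hae] with ω hω
    exact propext ⟨fun h => hle _ _ h, fun h => hlt _ _ (lt_of_le_of_ne h hω)⟩
  have hG : Measurable fun p : ℝ≥0 × ℝ≥0 =>
      {p : ℝ≥0 × ℝ≥0 | 0 < p.1 ∧ R p.2 p.1}.indicator (fun p => g (t - p.1)) p :=
    (by fun_prop : Measurable fun p : ℝ≥0 × ℝ≥0 => g (t - p.1)).indicator hset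
  calc _ = ∫⁻ ω, {p : ℝ≥0 × ℝ≥0 | 0 < p.1 ∧ R p.2 p.1}.indicator
        (fun p => g (t - p.1)) (A ω, C ω) ∂P := by
        have : MeasurableSet {ω | 0 < A ω ∧ R (C ω) (A ω)} := (hA.prodMk hC) hset
        rw [← lintegral_indicator this]
        rfl
    _ = ∫⁻ ω, ∫⁻ ω', {p : ℝ≥0 × ℝ≥0 | 0 < p.1 ∧ R p.2 p.1}.indicator
        (fun p => g (t - p.1)) (A ω, C ω') ∂P ∂P := by
        rw [← lintegral_map hG (hA.prodMk hC),
          (indepFun_iff_map_prod_eq_prod_map_map hA.aemeasurable hC.aemeasurable).1 hAC,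
          lintegral_prod _ hG.aemeasurable, lintegral_map hG.lintegral_prod_right' hA]
        refine lintegral_congr fun ω => ?_
        exact lintegral_map (hG.comp measurable_prodMk_left) hC
    _ = ∫⁻ ω in {ω | 0 < A ω}, ENNReal.ofReal (Real.exp (-(b * ((t : ℝ) - A ω)))) *
          g (t - A ω) ∂P := by
        rw [← lintegral_indicator (measurableSet_lt measurable_const hA)]
        refine lintegral_congr fun ω => ?_
        by_cases hω : 0 < A ω
        · rw [indicator_of_mem (by exact hω), ← hinner _ hω (hL.lastArrival_le t ω), mul_comm,
            ← setLIntegral_const]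
          have : MeasurableSet {ω' | R (C ω') (A ω)} :=
            (hC.prodMk (measurable_const (a := A ω))) hR
          rw [← lintegral_indicator this]
          refine lintegral_congr fun ω' => ?_
          by_cases h' : R (C ω') (A ω) <;> simp [indicator, hω, h']
        · rw [indicator_of_notMem (by exact hω)]
          simp [indicator, hω]
    _ = _ := by
        -- With `u` the age, the factor `e^{-bu}` for the silence of `M` multiplies the density `a
        -- e^{-au}`.
        rw [hL.lintegral_age t (g := fun u => ENNReal.ofReal (Real.exp (-(b * u))) * g u)
          (by fun_prop)]
        refine lintegral_congr fun u => ?_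
        rw [← mul_assoc, ← ENNReal.ofReal_mul (by positivity), mul_assoc, ← Real.exp_add]
        congr 4
        ring

end Age

/-! ### Continuity and semigroup property of the transition function -/

section Transition

variable {Q : ℕ → ℕ → ℝ} {r : ℝ≥0 → ℕ → ℕ → ℝ}

theorem IsTransitionFunction.le_one (hr : IsTransitionFunction Q r) (t : ℝ≥0) (m n : ℕ) :
    r t m n ≤ 1 :=
  le_hasSum (hr.hasSum_one t m) n fun k _ => hr.nonneg t m k

/-- In the Chapman-Kolmogorov sum, keeping only the term `k = m` bounds `r (s + t) m n` from below;
bounding `r t k n` by `1` for `k ≠ m` bounds it from above. The estimate is uniform in `t`. -/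
theorem IsTransitionFunction.abs_sub_le (hr : IsTransitionFunction Q r) (s t : ℝ≥0) (m n : ℕ) :
    |r (s + t) m n - r t m n| ≤ 1 - r s m m := by
  have h0 := hr.nonneg s m m
  have h1 := hr.le_one s m m
  have h2 := hr.nonneg t m n
  have h3 := hr.le_one t m n
  have lower : r s m m * r t m n ≤ r (s + t) m n :=
    le_hasSum (hr.add s t m n) m fun k _ => mul_nonneg (hr.nonneg _ _ _) (hr.nonneg _ _ _)
  have upper : r (s + t) m n ≤ 1 - r s m m * (1 - r t m n) := by
    refine hasSum_le (fun k => ?_) (hr.add s t m n)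
      ((hr.hasSum_one s m).sub (hasSum_ite_eq m (r s m m * (1 - r t m n))))
    by_cases hk : k = m
    · subst hk
      simp only [if_true]
      linarith
    · simp only [if_neg hk, sub_zero]
      exact mul_le_of_le_one_right (hr.nonneg _ _ _) (hr.le_one _ _ _)
  rw [abs_le]
  constructor <;> nlinarith

/-- Differentiability at `0` gives `r s m m → 1`, and `abs_sub_le` spreads this to uniform
continuity in time. It is needed for measurability under the integrals over ages. -/
theorem IsTransitionFunction.continuous (hr : IsTransitionFunction Q r) (m n : ℕ) :
    Continuous fun t => r t m n := by
  have h0 : Tendsto (fun s : ℝ => r s.toNNReal m m) (𝓝[≥] 0) (𝓝 1) := by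
    have := (hr.hasDerivWithinAt m m).continuousWithinAt
    simpa [ContinuousWithinAt, hr.zero] using this
  rw [Metric.continuous_iff]
  intro t ε hε
  have hev : ∀ᶠ s : ℝ in 𝓝[≥] 0, 1 - r s.toNNReal m m < ε := by
    have := h0.eventually (lt_mem_nhds (show 1 - ε < 1 by linarith))
    filter_upwards [this] with s hs
    linarith
  obtain ⟨δ, hδ, hδ'⟩ := (mem_nhdsGE_iff_exists_Ico_subset).1 hev
  have key : ∀ x y : ℝ≥0, x ≤ y → (y : ℝ) - x < δ → |r y m n - r x m n| < ε := by
    intro x y hxy hd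
    have h1 := hr.abs_sub_le (y - x) x m n
    rw [tsub_add_cancel_of_le hxy] at h1
    have h2 : ((y - x : ℝ≥0) : ℝ) ∈ Ico (0 : ℝ) δ := by
      rw [NNReal.coe_sub hxy]
      exact ⟨sub_nonneg.2 hxy, hd⟩
    have h3 : 1 - r (((y - x : ℝ≥0) : ℝ).toNNReal) m m < ε := hδ' h2
    rw [Real.toNNReal_coe] at h3
    linarith
  refine ⟨δ, hδ, fun s hs => ?_⟩
  rw [NNReal.dist_eq] at hs
  rw [Real.dist_eq]
  rcases le_total s t with h | h
  · rw [abs_sub_comm]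
    exact key s t h (by rw [abs_sub_comm] at hs; exact (le_abs_self _).trans_lt hs)
  · exact key t s h ((le_abs_self _).trans_lt hs)

/-- The law at time `u` of `1 + Y` started with distribution `ν`. -/
noncomputable def mixture (r : ℝ≥0 → ℕ → ℕ → ℝ) (ν : ℕ+ → ℝ≥0∞) (j : ℕ+) (u : ℝ≥0) : ℝ≥0∞ :=
  ∑' i, ν i * ENNReal.ofReal (shiftedTransition r u i j)

theorem IsTransitionFunction.measurable_mixture (hr : IsTransitionFunction Q r) (ν : ℕ+ → ℝ≥0∞)
    (j : ℕ+) : Measurable (mixture r ν j) :=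
  Measurable.tsum fun i =>
    ((hr.continuous i.natPred j.natPred).measurable.ennreal_ofReal).const_mul _

theorem IsTransitionFunction.mixture_le (hr : IsTransitionFunction Q r) (ν : ℕ+ → ℝ≥0∞)
    (j : ℕ+) (u : ℝ≥0) : mixture r ν j u ≤ ∑' i, ν i :=
  ENNReal.tsum_le_tsum fun i => mul_le_of_le_one_right' <| by
    simpa [shiftedTransition] using ENNReal.ofReal_le_ofReal (hr.le_one u i.natPred j.natPred)

theorem IsTransitionFunction.tsum_ofReal (hr : IsTransitionFunction Q r) (u : ℝ≥0) (i : ℕ+) :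
    ∑' j, ENNReal.ofReal (shiftedTransition r u i j) = 1 := by
  have h : ∑' n, ENNReal.ofReal (r u i.natPred n) = 1 := by
    rw [← ENNReal.ofReal_tsum_of_nonneg (hr.nonneg u _) (hr.hasSum_one u _).summable,
      (hr.hasSum_one u _).tsum_eq, ENNReal.ofReal_one]
  rw [← h]
  exact Equiv.pnatEquivNat.tsum_eq fun n => ENNReal.ofReal (r u i.natPred n)

theorem IsTransitionFunction.tsum_mixture (hr : IsTransitionFunction Q r) (ν : ℕ+ → ℝ≥0∞)
    (u : ℝ≥0) : ∑' j, mixture r ν j u = ∑' i, ν i := by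
  simp_rw [mixture]
  rw [ENNReal.tsum_comm]
  simp_rw [ENNReal.tsum_mul_left, hr.tsum_ofReal, mul_one]

theorem IsTransitionFunction.mixture_zero (hr : IsTransitionFunction Q r) (ν : ℕ+ → ℝ≥0∞)
    (j : ℕ+) : mixture r ν j 0 = ν j := by
  rw [mixture, tsum_eq_single j fun i hi => ?_]
  · simp [shiftedTransition, hr.zero]
  · have : i.natPred ≠ j.natPred := fun h => hi (PNat.natPred_injective h)
    simp [shiftedTransition, hr.zero, this]

/-- The Chapman-Kolmogorov equation. -/
theorem IsTransitionFunction.mixture_mixture (hr : IsTransitionFunction Q r) (ν : ℕ+ → ℝ≥0∞)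
    (j : ℕ+) (s t : ℝ≥0) :
    mixture r (fun i => mixture r ν i s) j t = mixture r ν j (s + t) := by
  have key : ∀ k : ℕ+, ∑' i : ℕ+, ENNReal.ofReal (shiftedTransition r s k i) *
      ENNReal.ofReal (shiftedTransition r t i j) =
      ENNReal.ofReal (shiftedTransition r (s + t) k j) := by
    intro k
    rw [shiftedTransition, ← (hr.add s t _ _).tsum_eq, ENNReal.ofReal_tsum_of_nonneg
      (fun n => mul_nonneg (hr.nonneg _ _ _) (hr.nonneg _ _ _)) (hr.add s t _ _).summable]
    simp_rw [ENNReal.ofReal_mul (hr.nonneg _ _ _)]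
    exact Equiv.pnatEquivNat.tsum_eq fun n =>
      ENNReal.ofReal (r s k.natPred n) * ENNReal.ofReal (r t n j.natPred)
  simp_rw [mixture, ← ENNReal.tsum_mul_right]
  rw [ENNReal.tsum_comm]
  refine tsum_congr fun k => ?_
  simp_rw [mul_assoc]
  rw [ENNReal.tsum_mul_left, key]

end Transition

/-! ### Queue paths evaluated at random times and from random starting values -/

section Queue

variable {Ω : Type*} [MeasurableSpace Ω] {P : Measure Ω} {r : ℝ≥0 → ℕ → ℕ → ℝ}

theorem IsMarkovFrom.measure_eq [IsFiniteMeasure P] {m : ℕ} {Y : ℝ≥0 → Ω → ℕ}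
    (hY : IsMarkovFrom r m Y P) (u : ℝ≥0) (n : ℕ) :
    P {ω | Y u ω = n} = ENNReal.ofReal (r u m n) := by
  have h := hY.fdd 0 (fun _ => u) (fun _ => n) monotone_const
  simp only [Finset.univ_eq_empty, Finset.prod_empty, mul_one, forall_const] at h
  rw [← h, ofReal_measureReal]

/-- Discretizes time from the right, which is the side on which the paths are continuous. -/
theorem exists_measurable_approx_right : ∃ k : ℕ → ℝ≥0 → ℕ, (∀ n, Measurable (k n)) ∧
    ∀ u, Tendsto (fun n => (k n u : ℝ≥0) / (n + 1)) atTop (𝓝[≥] u) := by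
  -- The `+ 1` after the floor puts the grid point to the right of `u`, at distance at most `1 / (n
  -- + 1)`.
  refine ⟨fun n u => ⌊((n : ℝ≥0) + 1) * u⌋₊ + 1, fun n => ?_, fun u => ?_⟩
  · exact (Nat.measurable_floor.comp (measurable_id.const_mul _)).add_const 1
  · have h1 : ∀ n : ℕ, u ≤ ((⌊((n : ℝ≥0) + 1) * u⌋₊ + 1 : ℕ) : ℝ≥0) / (n + 1) := fun n => by
      rw [le_div_iff₀ (by positivity), mul_comm]
      exact_mod_cast (Nat.lt_floor_add_one (((n : ℝ≥0) + 1) * u)).le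
    refine tendsto_nhdsWithin_iff.2 ⟨?_, .of_forall h1⟩
    refine tendsto_of_tendsto_of_tendsto_of_le_of_le tendsto_const_nhds
      (h := fun n : ℕ => u + 1 / ((n : ℝ≥0) + 1)) ?_ h1 fun n => ?_
    · simpa using (tendsto_const_nhds (x := u)).add
        (tendsto_one_div_add_atTop_nhds_zero_nat (𝕜 := ℝ≥0))
    · simp only
      rw [div_le_iff₀ (by positivity), add_mul u, div_mul_cancel₀ _ (by positivity), mul_comm u]
      push_cast
      gcongr
      exact Nat.floor_le zero_le

/-- A right-continuous process is jointly measurable. -/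
theorem measurable_uncurry_of_rightCts {Ω : Type*} {m : MeasurableSpace Ω} {Y : ℝ≥0 → Ω → ℕ}
    (hm : ∀ t, Measurable (Y t)) (hY : ∀ ω t, ContinuousWithinAt (fun s => Y s ω) (Ici t) t) :
    Measurable fun p : ℝ≥0 × Ω => Y p.1 p.2 := by
  obtain ⟨k, hk, hlim⟩ := exists_measurable_approx_right
  refine measurable_of_tendsto_metrizable
    (f := fun n (p : ℝ≥0 × Ω) => Y ((k n p.1 : ℝ≥0) / (n + 1)) p.2)
    (fun n => ?_) (tendsto_pi_nhds.2 fun p => (hY p.2 p.1).tendsto.comp (hlim p.1))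
  have h1 : Measurable fun p : ℕ × Ω => Y ((p.1 : ℝ≥0) / (n + 1)) p.2 :=
    measurable_from_prod_countable_right fun i => hm ((i : ℝ≥0) / (n + 1))
  have h2 : Measurable fun p : ℝ≥0 × Ω => (k n p.1, p.2) :=
    ((hk n).comp measurable_fst).prodMk measurable_snd
  exact h1.comp h2

/-- The law of `1 + Y` started at an independent random value. -/
theorem measure_succPNat_eq [IsFiniteMeasure P] {Y : ℕ → ℝ≥0 → Ω → ℕ}
    (hY : ∀ m, IsMarkovFrom r m (Y m) P) {Z : Ω → ℕ+} (hZ : Measurable Z)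
    (hind : ∀ m, Indep (MeasurableSpace.comap Z inferInstance) (history (Y m)) P)
    (u : ℝ≥0) (j : ℕ+) :
    P {ω | (Y (Z ω).natPred u ω).succPNat = j} = mixture r (fun i => P {ω | Z ω = i}) j u := by
  have hset : {ω | (Y (Z ω).natPred u ω).succPNat = j} =
      ⋃ i : ℕ+, {ω | Z ω = i} ∩ {ω | Y i.natPred u ω = j.natPred} := by
    ext ω
    simp only [mem_ofPred_eq, mem_iUnion, mem_inter_iff, exists_eq_left']
    constructor
    · rintro rfl; simp
    · intro h; simp [h]
  rw [hset, measure_iUnion]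
  · refine tsum_congr fun i => ?_
    rw [shiftedTransition, ← (hY i.natPred).measure_eq u j.natPred]
    exact (Indep_iff _ _ _).1 (hind i.natPred) _ _
      ⟨{i}, measurableSet_singleton i, rfl⟩
      ((measurable_history (Y i.natPred) u) (measurableSet_singleton j.natPred))
  · intro i k hik
    refine Set.disjoint_left.2 fun ω h h' => hik ?_
    exact h.1.symm.trans h'.1
  · exact fun i => (hZ (measurableSet_singleton i)).inter
      ((hY i.natPred).measurable u (measurableSet_singleton _))

/-- Fubini's theorem for independent random variables. -/
theorem IndepFun.measure_eq_lintegral {T Ω' : Type*} [MeasurableSpace T] [MeasurableSpace Ω']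
    [IsProbabilityMeasure P] {X : Ω → T} {Y : Ω → Ω'} (hX : Measurable X) (hY : Measurable Y)
    (h : IndepFun X Y P) {S : Set (T × Ω')} (hS : MeasurableSet S) :
    P {ω | (X ω, Y ω) ∈ S} = ∫⁻ ω, P {ω' | (X ω, Y ω') ∈ S} ∂P := by
  have : IsProbabilityMeasure (P.map Y) := Measure.isProbabilityMeasure_map hY.aemeasurable
  rw [show {ω | (X ω, Y ω) ∈ S} = (fun ω => (X ω, Y ω)) ⁻¹' S from rfl,
    ← Measure.map_apply (hX.prodMk hY) hS,
    (indepFun_iff_map_prod_eq_prod_map_map hX.aemeasurable hY.aemeasurable).1 h,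
    Measure.prod_apply hS, lintegral_map (measurable_measure_prodMk_left hS) hX]
  exact lintegral_congr fun ω => Measure.map_apply hY (measurable_prodMk_left hS)

/-- Fubini's theorem for a random variable independent of a sub-σ-algebra. -/
theorem measure_eq_lintegral_of_indep {T Ω : Type*} [MeasurableSpace T] {m mΩ : MeasurableSpace Ω}
    {P : Measure Ω} [IsProbabilityMeasure P] (hm : m ≤ mΩ) {X : Ω → T} (hX : Measurable X)
    (h : Indep (MeasurableSpace.comap X inferInstance) m P) {S : Set (T × Ω)}
    (hS : @MeasurableSet (T × Ω) (@Prod.instMeasurableSpace T Ω _ m) S) :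
    P {ω | (X ω, ω) ∈ S} = ∫⁻ ω, P {ω' | (X ω, ω') ∈ S} ∂P := by
  -- The second variable is the identity from `Ω` to `Ω` equipped with the smaller σ-algebra `m`.
  refine @IndepFun.measure_eq_lintegral Ω _ P T Ω _ m _ X id hX (measurable_id'' hm) ?_ S hS
  exact @indepFun_of_indep Ω mΩ P T Ω _ m _ m h X id (comap_measurable X) (@measurable_id Ω m)

end Queue

/-! ### Law of the volume, by conditioning on the clocks -/

section Model

variable {Ω : Type*}

/-- The volume at time `t` as a function of the values `c.1`, `c.2.1` of the two clocks and of
their last arrivals `c.2.2.1`, `c.2.2.2`. -/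
noncomputable def Inputs.volumeOf (D : Inputs Ω) (t : ℝ≥0) (c : ℕ × ℕ × ℝ≥0 × ℝ≥0) (ω : Ω) : ℕ+ :=
  (D.queue (c.1 + c.2.1)
    (if c.1 + c.2.1 = 0 then D.initial ω else if c.2.2.2 < c.2.2.1 then D.limitSize c.1 ω
      else D.nextVolume c.2.1 ω).natPred (t - max c.2.2.1 c.2.2.2) ω).succPNat

/-- The values of the two clocks and their last arrivals. -/
noncomputable def Inputs.clockData (D : Inputs Ω) (t : ℝ≥0) (ω : Ω) : ℕ × ℕ × ℝ≥0 × ℝ≥0 :=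
  (D.limitClock t ω, D.marketClock t ω, lastArrival D.limitClock t ω, lastArrival D.marketClock t ω)

theorem Inputs.measurable_volumeOf [MeasurableSpace Ω] (D : Inputs Ω)
    (h₀ : Measurable D.initial) (h₁ : ∀ k, Measurable (D.limitSize k))
    (h₂ : ∀ k, Measurable (D.nextVolume k)) (h₃ : ∀ n m t, Measurable (D.queue n m t))
    (h₄ : ∀ n m ω t, ContinuousWithinAt (fun s => D.queue n m s ω) (Ici t) t) (t : ℝ≥0) :
    Measurable fun p : (ℕ × ℕ × ℝ≥0 × ℝ≥0) × Ω => D.volumeOf t p.1 p.2 := by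
  have hpath : Measurable fun p : (ℕ × ℕ) × (ℝ≥0 × Ω) => D.queue p.1.1 p.1.2 p.2.1 p.2.2 :=
    measurable_from_prod_countable_right fun k =>
      measurable_uncurry_of_rightCts (h₃ k.1 k.2) (h₄ k.1 k.2)
  have hl : Measurable fun p : ℕ × Ω => D.limitSize p.1 p.2 :=
    measurable_from_prod_countable_right h₁
  have hm : Measurable fun p : ℕ × Ω => D.nextVolume p.1 p.2 :=
    measurable_from_prod_countable_right h₂
  have hsum : Measurable fun p : (ℕ × ℕ × ℝ≥0 × ℝ≥0) × Ω => p.1.1 + p.1.2.1 := by fun_prop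
  have hreset : Measurable fun p : (ℕ × ℕ × ℝ≥0 × ℝ≥0) × Ω =>
      if p.1.1 + p.1.2.1 = 0 then D.initial p.2 else if p.1.2.2.2 < p.1.2.2.1 then
        D.limitSize p.1.1 p.2 else D.nextVolume p.1.2.1 p.2 := by
    refine Measurable.ite (hsum (measurableSet_singleton 0)) (h₀.comp measurable_snd) ?_
    refine Measurable.ite (measurableSet_lt (by fun_prop) (by fun_prop)) ?_ ?_
    · exact hl.comp ((measurable_fst.comp measurable_fst).prodMk measurable_snd)
    · exact hm.comp (((measurable_fst.comp measurable_snd).comp measurable_fst).prodMk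
        measurable_snd)
  have hage : Measurable fun p : (ℕ × ℕ × ℝ≥0 × ℝ≥0) × Ω => t - max p.1.2.2.1 p.1.2.2.2 := by
    fun_prop
  exact (measurable_from_top (f := Nat.succPNat)).comp (hpath.comp
    ((hsum.prodMk ((measurable_from_top (f := PNat.natPred)).comp hreset)).prodMk
      (hage.prodMk measurable_snd)))

variable [mΩ : MeasurableSpace Ω] {P : Measure Ω} {D : Inputs Ω} {B : Params}
  {r : ℝ≥0 → ℕ → ℕ → ℝ}

theorem Inputs.IsModel.sigma_le (hD : D.IsModel B r P) (i : InputLabel) : D.sigma i ≤ mΩ := by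
  cases i with
  | initial => exact hD.measurable_initial.comap_le
  | limitClock => exact history_le hD.limitClock.measurable
  | marketClock => exact history_le hD.marketClock.measurable
  | limitSize k => exact (hD.measurable_limitSize k).comap_le
  | nextVolume k => exact (hD.measurable_nextVolume k).comap_le
  | queue n m => exact history_le (hD.queue n m).measurable

theorem Inputs.IsModel.indep_clocks (hD : D.IsModel B r P) :
    Indep (history D.limitClock) (history D.marketClock) P :=
  hD.indep.indep (i := .limitClock) (j := .marketClock) (by simp)

theorem Inputs.IsModel.isPoissonProcess_priceMoves [IsProbabilityMeasure P]
    (hD : D.IsModel B r P) : IsPoissonProcess (B.lam0 + B.muA) D.priceMoves P :=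
  hD.limitClock.add hD.marketClock hD.indep_clocks

theorem Inputs.IsModel.lastArrival_priceMoves [IsProbabilityMeasure P] (hD : D.IsModel B r P)
    (t : ℝ≥0) (ω : Ω) : lastArrival D.priceMoves t ω =
      max (lastArrival D.limitClock t ω) (lastArrival D.marketClock t ω) :=
  hD.limitClock.lastArrival_add hD.marketClock hD.isPoissonProcess_priceMoves t ω

theorem Inputs.IsModel.volume_eq [IsProbabilityMeasure P] (hD : D.IsModel B r P) (t : ℝ≥0)
    (ω : Ω) : D.volume t ω = D.volumeOf t (D.clockData t ω) ω := by
  rw [Inputs.volume, hD.lastArrival_priceMoves]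
  rfl

/-- The labels of the two clocks. -/
def clockLabels : Set InputLabel := {.limitClock, .marketClock}

/-- The σ-algebra of the clocks alone is what independence from the other inputs requires. -/
theorem Inputs.IsModel.measurable_clockData' (hD : D.IsModel B r P) (t : ℝ≥0) :
    Measurable[⨆ i ∈ clockLabels, D.sigma i] (D.clockData t) := by
  have hl : history D.limitClock ≤ ⨆ i ∈ clockLabels, D.sigma i :=
    le_biSup D.sigma (i := .limitClock) (by simp [clockLabels])
  have hm : history D.marketClock ≤ ⨆ i ∈ clockLabels, D.sigma i :=
    le_biSup D.sigma (i := .marketClock) (by simp [clockLabels])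
  exact ((measurable_history _ t).mono hl le_rfl).prodMk
    (((measurable_history _ t).mono hm le_rfl).prodMk
    (((hD.limitClock.measurable_lastArrival t).mono hl le_rfl).prodMk
    ((hD.marketClock.measurable_lastArrival t).mono hm le_rfl)))

theorem Inputs.IsModel.measurable_clockData (hD : D.IsModel B r P) (t : ℝ≥0) :
    Measurable (D.clockData t) :=
  (hD.measurable_clockData' t).mono (iSup₂_le fun i _ => hD.sigma_le i) le_rfl

/-- With the clock data as a separate argument, only the non-clock inputs remain random; their
σ-algebra is independent of the clocks. -/
theorem Inputs.IsModel.measurable_volumeOf (hD : D.IsModel B r P) (t : ℝ≥0) :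
    @Measurable ((ℕ × ℕ × ℝ≥0 × ℝ≥0) × Ω) ℕ+
      (@Prod.instMeasurableSpace _ _ _ (⨆ i ∈ clockLabelsᶜ, D.sigma i)) _
      fun p => D.volumeOf t p.1 p.2 := by
  have hle : ∀ i ∈ clockLabelsᶜ, D.sigma i ≤ ⨆ i ∈ clockLabelsᶜ, D.sigma i :=
    fun i hi => le_biSup D.sigma hi
  refine @Inputs.measurable_volumeOf Ω (⨆ i ∈ clockLabelsᶜ, D.sigma i) D ?_ ?_ ?_ ?_
    (fun n m => (hD.queue n m).rightCts) t
  · exact (comap_measurable _).mono (hle .initial (by simp [clockLabels])) le_rfl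
  · exact fun k => (comap_measurable _).mono (hle (.limitSize k) (by simp [clockLabels])) le_rfl
  · exact fun k => (comap_measurable _).mono (hle (.nextVolume k) (by simp [clockLabels])) le_rfl
  · exact fun n m t => (measurable_history (D.queue n m) t).mono
      (hle (.queue n m) (by simp [clockLabels])) le_rfl

theorem Inputs.IsModel.measurable_volume [IsProbabilityMeasure P] (hD : D.IsModel B r P)
    (t : ℝ≥0) : Measurable (D.volume t) := by
  have h : Measurable fun p : (ℕ × ℕ × ℝ≥0 × ℝ≥0) × Ω => D.volumeOf t p.1 p.2 :=
    D.measurable_volumeOf hD.measurable_initial hD.measurable_limitSize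
      hD.measurable_nextVolume (fun n m => (hD.queue n m).measurable)
      (fun n m => (hD.queue n m).rightCts) t
  rw [funext (hD.volume_eq t)]
  exact h.comp ((hD.measurable_clockData t).prodMk measurable_id)

/-- The law of the volume, given the clocks. -/
theorem Inputs.IsModel.measure_volumeOf [IsProbabilityMeasure P] (hD : D.IsModel B r P)
    (t : ℝ≥0) (c : ℕ × ℕ × ℝ≥0 × ℝ≥0) (j : ℕ+) :
    P {ω | D.volumeOf t c ω = j} =
      mixture r (if c.1 + c.2.1 = 0 then fun i => P {ω | D.initial ω = i}
        else if c.2.2.2 < c.2.2.1 then B.g0 else B.pi2) j (t - max c.2.2.1 c.2.2.2) := by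
  -- The three sources of a reset value are treated alike: each has a label that is not a queue,
  -- hence is independent of every queue path.
  have key : ∀ (i : InputLabel) (Z : Ω → ℕ+), D.sigma i = MeasurableSpace.comap Z inferInstance →
      (∀ n m, i ≠ .queue n m) → ∀ (n : ℕ) (u : ℝ≥0),
      P {ω | (D.queue n (Z ω).natPred u ω).succPNat = j} =
        mixture r (fun i => P {ω | Z ω = i}) j u := by
    intro i Z hi hne n u
    refine measure_succPNat_eq (hD.queue n) (Measurable.of_comap_le (hi ▸ hD.sigma_le i))
      (fun m => ?_) u j
    rw [← hi]
    exact hD.indep.indep (hne n m)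
  unfold Inputs.volumeOf
  split_ifs with h1 h2
  · exact key .initial D.initial rfl (by simp) _ _
  · rw [key (.limitSize c.1) (D.limitSize c.1) rfl (by simp)]
    simp_rw [hD.limitSize]
  · rw [key (.nextVolume c.2.1) (D.nextVolume c.2.1) rfl (by simp)]
    simp_rw [hD.nextVolume]

/-- Fubini freezes the clocks, so the index of the queue, the choice of the reset value and the age
become deterministic in the inner probability. -/
theorem Inputs.IsModel.measure_volume_eq_lintegral [IsProbabilityMeasure P]
    (hD : D.IsModel B r P) (t : ℝ≥0) (j : ℕ+) :
    P {ω | D.volume t ω = j} = ∫⁻ ω, P {ω' | D.volumeOf t (D.clockData t ω) ω' = j} ∂P := by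
  have hind : Indep (MeasurableSpace.comap (D.clockData t) inferInstance)
      (⨆ i ∈ clockLabelsᶜ, D.sigma i) P :=
    indep_of_indep_of_le_left
      (indep_iSup_of_disjoint hD.sigma_le hD.indep disjoint_compl_right)
      (hD.measurable_clockData' t).comap_le
  simp_rw [hD.volume_eq t]
  exact measure_eq_lintegral_of_indep (iSup₂_le fun i _ => hD.sigma_le i)
    (hD.measurable_clockData t) hind (hD.measurable_volumeOf t (measurableSet_singleton j))

/-- The law of the volume at time `t`. -/
theorem Inputs.IsModel.measure_volume [IsProbabilityMeasure P] {Q : ℕ → ℕ → ℝ}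
    (hr : IsTransitionFunction Q r) (hD : D.IsModel B r P) (t : ℝ≥0) (j : ℕ+) :
    P {ω | D.volume t ω = j} =
      ENNReal.ofReal (Real.exp (-((B.lam0 + B.muA) * t))) *
          mixture r (fun i => P {ω | D.initial ω = i}) j t +
        ((∫⁻ u in Ico (0 : ℝ) t, ENNReal.ofReal (B.lam0 * Real.exp (-((B.lam0 + B.muA) * u))) *
            mixture r B.g0 j u.toNNReal) +
          ∫⁻ u in Ico (0 : ℝ) t, ENNReal.ofReal (B.muA * Real.exp (-((B.lam0 + B.muA) * u))) *
            mixture r B.pi2 j u.toNNReal) := by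
  have hL := hD.limitClock
  have hM := hD.marketClock
  set A := lastArrival D.limitClock t with hAdef
  set C := lastArrival D.marketClock t with hCdef
  have hA : Measurable A := (hL.measurable_lastArrival t).mono (history_le hL.measurable) le_rfl
  have hC : Measurable C := (hM.measurable_lastArrival t).mono (history_le hM.measurable) le_rfl
  let G : (ℕ+ → ℝ≥0∞) → ℝ → ℝ≥0∞ := fun ν u => mixture r ν j u.toNNReal
  have hG : ∀ ν, Measurable (G ν) := fun ν =>
    (hr.measurable_mixture ν j).comp measurable_real_toNNReal
  have hS0 : MeasurableSet {ω | max (A ω) (C ω) ≤ 0} :=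
    measurableSet_le (hA.max hC) measurable_const
  have hS1 : MeasurableSet {ω | 0 < A ω ∧ C ω < A ω} :=
    MeasurableSet.inter (measurableSet_lt measurable_const hA : MeasurableSet {ω | 0 < A ω})
      (measurableSet_lt hC hA : MeasurableSet {ω | C ω < A ω})
  have hS2 : MeasurableSet {ω | 0 < C ω ∧ A ω ≤ C ω} :=
    MeasurableSet.inter (measurableSet_lt measurable_const hC : MeasurableSet {ω | 0 < C ω})
      (measurableSet_le hA hC : MeasurableSet {ω | A ω ≤ C ω})
  have hAt : ∀ ω, A ω ≤ t := hL.lastArrival_le t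
  have hCt : ∀ ω, C ω ≤ t := hM.lastArrival_le t
  have hm1 : Measurable fun ω => G B.g0 (t - A ω) := (hG _).comp (by fun_prop)
  have hm2 : Measurable fun ω => G B.pi2 (t - C ω) := (hG _).comp (by fun_prop)
  -- Three disjoint cases: no move, last move by a limit order, last move by a market order. Ties go
  -- to the market order, as in `resetVolume`.
  have hpt : ∀ ω, P {ω' | D.volumeOf t (D.clockData t ω) ω' = j} =
      {ω | max (A ω) (C ω) ≤ 0}.indicator
          (fun _ => mixture r (fun i => P {ω | D.initial ω = i}) j t) ω +
        ({ω | 0 < A ω ∧ C ω < A ω}.indicator (fun ω => G B.g0 (t - A ω)) ω +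
          {ω | 0 < C ω ∧ A ω ≤ C ω}.indicator (fun ω => G B.pi2 (t - C ω)) ω) := by
    intro ω
    rw [hD.measure_volumeOf]
    have hA0 : A ω = 0 ↔ D.limitClock t ω = 0 := hL.lastArrival_eq_zero_iff
    have hC0 : C ω = 0 ↔ D.marketClock t ω = 0 := hM.lastArrival_eq_zero_iff
    have hsum : D.limitClock t ω + D.marketClock t ω = 0 ↔ A ω = 0 ∧ C ω = 0 := by
      rw [hA0, hC0]; omega
    have hsub : ∀ x : ℝ≥0, ((t : ℝ) - x).toNNReal = t - x := fun x => by
      rw [NNReal.sub_def]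
    simp only [Inputs.clockData, ← hAdef, ← hCdef, hsum, G, hsub]
    rcases lt_or_ge (C ω) (A ω) with h | h
    · have hpos : 0 < A ω := zero_le.trans_lt h
      simp [indicator, h, h.le, hpos, hpos.ne', not_le.2 h]
    · rcases eq_or_ne (C ω) 0 with h0 | h0
      · have hA' : A ω = 0 := le_antisymm (h.trans h0.le) zero_le
        simp [indicator, h0, hA']
      · simp [indicator, h0, h, pos_iff_ne_zero.2 h0, not_lt.2 h]
  have hP0 : P {ω | max (A ω) (C ω) ≤ 0} =
      ENNReal.ofReal (Real.exp (-((B.lam0 + B.muA) * t))) := by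
    have := hD.isPoissonProcess_priceMoves.measure_lastArrival_le (s := 0) (t := t) zero_le
    simp_rw [hD.lastArrival_priceMoves] at this
    rw [this]
    simp
  rw [hD.measure_volume_eq_lintegral]
  simp_rw [hpt]
  rw [lintegral_add_left (measurable_const.indicator hS0),
    lintegral_add_left (hm1.indicator hS1), lintegral_indicator hS0, lintegral_indicator hS1,
    lintegral_indicator hS2, setLIntegral_const, hP0, mul_comm]
  congr 2
  · exact lintegral_age_of_last hL hM hD.indep_clocks t (hG B.g0) (R := fun x y => x < y)
      (measurableSet_lt measurable_fst measurable_snd) (fun _ _ h => h) (fun _ _ h => h.le)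
  · rw [add_comm (B.lam0 : ℝ)]
    exact lintegral_age_of_last hM hL hD.indep_clocks.symm t (hG B.pi2) (R := fun x y => x ≤ y)
      (measurableSet_le measurable_fst measurable_snd) (fun _ _ h => h.le) (fun _ _ h => h)

end Model

/-! ### The distribution `π`: total mass, invariance and uniqueness -/

section Stationary

variable {B : Params} {Q : ℕ → ℕ → ℝ} {r : ℝ≥0 → ℕ → ℕ → ℝ}

/-- The mixture `h`, with values in `ℝ≥0∞`. -/
noncomputable def Params.resetLaw (B : Params) (i : ℕ+) : ℝ≥0∞ := ENNReal.ofReal (B.h i)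

/-- The density of the exponential distribution with rate `λ₀ + μ_A`. -/
noncomputable def Params.moveDensity (B : Params) (u : ℝ) : ℝ≥0∞ :=
  ENNReal.ofReal ((B.lam0 + B.muA) * Real.exp (-((B.lam0 + B.muA) * u)))

/-- The distribution `π`, with values in `ℝ≥0∞`. -/
noncomputable def Params.stationaryLaw (B : Params) (r : ℝ≥0 → ℕ → ℕ → ℝ) (j : ℕ+) : ℝ≥0∞ :=
  ∫⁻ u in Ici (0 : ℝ), B.moveDensity u * mixture r B.resetLaw j u.toNNReal

theorem Params.measurable_moveDensity (B : Params) : Measurable B.moveDensity := by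
  unfold Params.moveDensity
  fun_prop

theorem Params.h_nonneg (B : Params) (i : ℕ+) : 0 ≤ B.h i := by
  unfold Params.h
  positivity

theorem hasSum_pmf_toReal {α : Type*} (p : PMF α) : HasSum (fun i => (p i).toReal) 1 := by
  have h := ENNReal.hasSum_toReal (f := p) (by rw [p.tsum_coe]; exact ENNReal.one_ne_top)
  rwa [← ENNReal.tsum_toReal_eq p.apply_ne_top, p.tsum_coe, ENNReal.toReal_one] at h

theorem Params.hasSum_h (hB : 0 < B.lam0 + B.muA) : HasSum B.h 1 := by
  have hc : (0 : ℝ) < B.lam0 + B.muA := by exact_mod_cast hB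
  have h := (((hasSum_pmf_toReal B.g0).mul_left (B.lam0 : ℝ)).div_const (B.lam0 + B.muA : ℝ)).add
    (((hasSum_pmf_toReal B.pi2).mul_left (B.muA : ℝ)).div_const (B.lam0 + B.muA : ℝ))
  rwa [mul_one, mul_one, ← add_div, div_self hc.ne'] at h

theorem Params.tsum_resetLaw (hB : 0 < B.lam0 + B.muA) : ∑' i, B.resetLaw i = 1 := by
  unfold Params.resetLaw
  rw [← ENNReal.ofReal_tsum_of_nonneg B.h_nonneg (Params.hasSum_h hB).summable,
    (Params.hasSum_h hB).tsum_eq, ENNReal.ofReal_one]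

/-- Clears the denominator of `h`, so that the integrals for the two order types merge into one. -/
theorem Params.mixture_resetLaw (hB : 0 < B.lam0 + B.muA) (j : ℕ+) (u : ℝ≥0) :
    ENNReal.ofReal (B.lam0 + B.muA) * mixture r B.resetLaw j u =
      ENNReal.ofReal B.lam0 * mixture r B.g0 j u + ENNReal.ofReal B.muA * mixture r B.pi2 j u := by
  have hc : (0 : ℝ) < B.lam0 + B.muA := by exact_mod_cast hB
  simp_rw [mixture, ← ENNReal.tsum_mul_left]
  rw [← ENNReal.tsum_add]
  refine tsum_congr fun i => ?_
  rw [← mul_assoc, ← mul_assoc, ← mul_assoc, ← add_mul]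
  congr 1
  rw [Params.resetLaw, ← ENNReal.ofReal_mul hc.le, Params.h, ← add_div,
    mul_div_cancel₀ _ hc.ne', ENNReal.ofReal_add (by positivity) (by positivity),
    ENNReal.ofReal_mul (by positivity), ENNReal.ofReal_mul (by positivity),
    ENNReal.ofReal_toReal (B.g0.apply_ne_top i), ENNReal.ofReal_toReal (B.pi2.apply_ne_top i)]

theorem Params.summable_f (hB : 0 < B.lam0 + B.muA) (hr : IsTransitionFunction Q r) (j : ℕ+)
    (u : ℝ≥0) : Summable fun i : ℕ+ => B.h i * shiftedTransition r u i j :=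
  Summable.of_nonneg_of_le (fun i => mul_nonneg (B.h_nonneg i) (hr.nonneg _ _ _))
    (fun i => mul_le_of_le_one_right (B.h_nonneg i) (hr.le_one _ _ _)) (Params.hasSum_h hB).summable

theorem Params.f_nonneg (hr : IsTransitionFunction Q r) (j : ℕ+) (t : ℝ) : 0 ≤ B.f r j t :=
  tsum_nonneg fun i => mul_nonneg (B.h_nonneg i) (hr.nonneg _ _ _)

theorem Params.ofReal_f (hB : 0 < B.lam0 + B.muA) (hr : IsTransitionFunction Q r) (j : ℕ+)
    (t : ℝ) : ENNReal.ofReal (B.f r j t) = mixture r B.resetLaw j t.toNNReal := by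
  rw [Params.f, ENNReal.ofReal_tsum_of_nonneg (f := fun i => B.h i * shiftedTransition r _ i j)
    (fun i => mul_nonneg (B.h_nonneg i) (hr.nonneg _ _ _)) (Params.summable_f hB hr j _)]
  exact tsum_congr fun i => ENNReal.ofReal_mul (B.h_nonneg i)

theorem Params.f_le_one (hB : 0 < B.lam0 + B.muA) (hr : IsTransitionFunction Q r) (j : ℕ+)
    (t : ℝ) : B.f r j t ≤ 1 := by
  rw [← ENNReal.ofReal_le_one, Params.ofReal_f hB hr, ← Params.tsum_resetLaw hB]
  exact hr.mixture_le _ _ _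

theorem Params.measurable_f (hB : 0 < B.lam0 + B.muA) (hr : IsTransitionFunction Q r) (j : ℕ+) :
    Measurable (B.f r j) := by
  have h : B.f r j = fun t => (mixture r B.resetLaw j t.toNNReal).toReal := by
    ext t
    rw [← Params.ofReal_f hB hr, ENNReal.toReal_ofReal (Params.f_nonneg hr j t)]
  rw [h]
  exact ((hr.measurable_mixture _ j).comp measurable_real_toNNReal).ennreal_toReal

theorem Params.integrableOn_exp (hB : 0 < B.lam0 + B.muA) :
    IntegrableOn (fun t : ℝ => Real.exp (-((B.lam0 + B.muA : ℝ) * t))) (Ioi 0) := by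
  have hc : (0 : ℝ) < B.lam0 + B.muA := by exact_mod_cast hB
  simpa only [neg_mul] using exp_neg_integrableOn_Ioi 0 hc

theorem Params.integrableOn_laplace (hB : 0 < B.lam0 + B.muA) (hr : IsTransitionFunction Q r)
    (j : ℕ+) : IntegrableOn
      (fun t : ℝ => Real.exp (-((B.lam0 + B.muA : ℝ) * t)) * B.f r j t) (Ioi 0) := by
  refine Integrable.mono' (Params.integrableOn_exp hB) ?_ (.of_forall fun t => ?_)
  · exact ((by fun_prop : Measurable fun t : ℝ => Real.exp (-((B.lam0 + B.muA : ℝ) * t))).mul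
      (Params.measurable_f hB hr j)).aestronglyMeasurable
  · rw [Real.norm_of_nonneg (mul_nonneg (Real.exp_pos _).le (Params.f_nonneg hr j t))]
    exact mul_le_of_le_one_right (Real.exp_pos _).le (Params.f_le_one hB hr j t)

theorem Params.stationary_nonneg (hr : IsTransitionFunction Q r) (j : ℕ+) :
    0 ≤ B.stationary r j := by
  refine mul_nonneg (by positivity) (integral_nonneg fun t => ?_)
  exact mul_nonneg (Real.exp_pos _).le (Params.f_nonneg hr j t)

theorem Params.ofReal_stationary (hB : 0 < B.lam0 + B.muA) (hr : IsTransitionFunction Q r)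
    (j : ℕ+) : ENNReal.ofReal (B.stationary r j) = B.stationaryLaw r j := by
  have hc : (0 : ℝ) < B.lam0 + B.muA := by exact_mod_cast hB
  rw [Params.stationary, laplace, ← integral_const_mul, ofReal_integral_eq_lintegral_ofReal
    ((Params.integrableOn_laplace hB hr j).const_mul _) (.of_forall fun t => mul_nonneg hc.le
      (mul_nonneg (Real.exp_pos _).le (Params.f_nonneg hr j t))),
    Params.stationaryLaw, setLIntegral_congr Ioi_ae_eq_Ici]
  refine lintegral_congr fun t => ?_
  rw [← mul_assoc, ENNReal.ofReal_mul (by positivity), Params.ofReal_f hB hr, Params.moveDensity]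

theorem Params.lintegral_moveDensity (hB : 0 < B.lam0 + B.muA) :
    ∫⁻ u in Ici (0 : ℝ), B.moveDensity u = 1 := by
  have hc : (0 : ℝ) < B.lam0 + B.muA := by exact_mod_cast hB
  unfold Params.moveDensity
  rw [← setLIntegral_congr Ioi_ae_eq_Ici, ← ofReal_integral_eq_lintegral_ofReal
    ((Params.integrableOn_exp hB).const_mul _) (.of_forall fun t => by positivity),
    integral_const_mul]
  simp_rw [← neg_mul]
  rw [integral_exp_mul_Ioi (by linarith) 0, mul_zero, Real.exp_zero, neg_div_neg_eq,
    mul_one_div_cancel hc.ne', ENNReal.ofReal_one]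

/-- Each `h p(u)` has total mass one, and `π` averages them over an exponential age. -/
theorem Params.tsum_stationaryLaw (hB : 0 < B.lam0 + B.muA) (hr : IsTransitionFunction Q r) :
    ∑' j, B.stationaryLaw r j = 1 := by
  unfold Params.stationaryLaw
  rw [← lintegral_tsum (f := fun j u => B.moveDensity u * mixture r B.resetLaw j u.toNNReal)
    fun j => (B.measurable_moveDensity.mul
      ((hr.measurable_mixture _ j).comp measurable_real_toNNReal)).aemeasurable]
  simp_rw [ENNReal.tsum_mul_left, hr.tsum_mixture, Params.tsum_resetLaw hB, mul_one]
  exact Params.lintegral_moveDensity hB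

theorem Params.hasSum_stationary (hB : 0 < B.lam0 + B.muA) (hr : IsTransitionFunction Q r) :
    HasSum (B.stationary r) 1 := by
  have h1 : B.stationary r = fun j => (B.stationaryLaw r j).toReal := by
    ext j
    rw [← Params.ofReal_stationary hB hr, ENNReal.toReal_ofReal (Params.stationary_nonneg hr j)]
  have h2 : ∑' j, B.stationaryLaw r j ≠ ∞ := by
    rw [Params.tsum_stationaryLaw hB hr]; exact ENNReal.one_ne_top
  have h3 := ENNReal.hasSum_toReal h2
  rwa [← ENNReal.tsum_toReal_eq fun j => ENNReal.ne_top_of_tsum_ne_top h2 j,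
    Params.tsum_stationaryLaw hB hr, ENNReal.toReal_one, ← h1] at h3

/-- The contribution to `π` of the ages larger than `t`. -/
theorem Params.lintegral_Ici_moveDensity (hr : IsTransitionFunction Q r) (j : ℕ+) (t : ℝ≥0) :
    ∫⁻ u in Ici (t : ℝ), B.moveDensity u * mixture r B.resetLaw j u.toNNReal =
      ENNReal.ofReal (Real.exp (-((B.lam0 + B.muA) * t))) * mixture r (B.stationaryLaw r) j t := by
  have hm : ∀ i, Measurable fun u : ℝ => B.moveDensity u * mixture r B.resetLaw i u.toNNReal :=
    fun i => B.measurable_moveDensity.mul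
      ((hr.measurable_mixture _ i).comp measurable_real_toNNReal)
  -- Translation by `t` moves the tail to `[0, ∞)`; the density then yields the factor `e^{-ct}`.
  rw [← lintegral_indicator measurableSet_Ici,
    ← lintegral_add_right_eq_self _ (t : ℝ)]
  have h1 : mixture r (B.stationaryLaw r) j t = ∫⁻ u in Ici (0 : ℝ), ∑' i,
      B.moveDensity u * mixture r B.resetLaw i u.toNNReal *
        ENNReal.ofReal (shiftedTransition r t i j) := by
    rw [lintegral_tsum fun i => ((hm i).mul_const _).aemeasurable]
    exact tsum_congr fun i => (lintegral_mul_const _ (hm i)).symm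
  rw [h1, ← lintegral_const_mul _ (Measurable.tsum fun i => (hm i).mul_const _),
    ← lintegral_indicator measurableSet_Ici]
  refine lintegral_congr fun u => ?_
  by_cases hu : 0 ≤ u
  · rw [indicator_of_mem (by simpa using hu), indicator_of_mem (by simpa using hu)]
    simp_rw [mul_assoc]
    rw [ENNReal.tsum_mul_left, ← mul_assoc]
    -- Running for time `u` from `h` and then for time `t` is running for time `u + t`.
    have h2 := hr.mixture_mixture B.resetLaw j u.toNNReal t
    rw [mixture] at h2
    rw [h2, Real.toNNReal_add hu t.coe_nonneg, Real.toNNReal_coe, Params.moveDensity,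
      Params.moveDensity, ← ENNReal.ofReal_mul (by positivity)]
    congr 2
    rw [mul_left_comm, ← Real.exp_add]
    congr 2
    ring
  · rw [indicator_of_notMem (by simpa using hu), indicator_of_notMem (by simpa using hu)]

variable {Ω : Type*} [MeasurableSpace Ω] {P : Measure Ω} [IsProbabilityMeasure P] {D : Inputs Ω}

/-- The law of the volume at time `t`, in terms of the mixture `h`. -/
theorem Inputs.IsModel.measure_volume_eq (hB : 0 < B.lam0 + B.muA)
    (hr : IsTransitionFunction Q r) (hD : D.IsModel B r P) (t : ℝ≥0) (j : ℕ+) :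
    P {ω | D.volume t ω = j} =
      ENNReal.ofReal (Real.exp (-((B.lam0 + B.muA) * t))) *
          mixture r (fun i => P {ω | D.initial ω = i}) j t +
        ∫⁻ u in Ico (0 : ℝ) t, B.moveDensity u * mixture r B.resetLaw j u.toNNReal := by
  rw [hD.measure_volume hr, ← lintegral_add_left]
  · congr 1
    refine lintegral_congr fun u => ?_
    rw [Params.moveDensity, ENNReal.ofReal_mul (by positivity), ENNReal.ofReal_mul (by positivity),
      ENNReal.ofReal_mul (by positivity), mul_right_comm, mul_right_comm _ _ (mixture r B.pi2 _ _),
      ← add_mul, ← Params.mixture_resetLaw hB, mul_right_comm]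
  · exact (by fun_prop : Measurable fun u : ℝ =>
      ENNReal.ofReal (B.lam0 * Real.exp (-((B.lam0 + B.muA) * u)))).mul
      ((hr.measurable_mixture _ j).comp measurable_real_toNNReal)

theorem Inputs.IsModel.measure_volume_zero (hB : 0 < B.lam0 + B.muA)
    (hr : IsTransitionFunction Q r) (hD : D.IsModel B r P) (j : ℕ+) :
    P {ω | D.volume 0 ω = j} = P {ω | D.initial ω = j} := by
  rw [hD.measure_volume_eq hB hr, hr.mixture_zero]
  simp

/-- The law of the volume converges to `π`. -/
theorem Inputs.IsModel.tendsto_measure_volume (hB : 0 < B.lam0 + B.muA)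
    (hr : IsTransitionFunction Q r) (hD : D.IsModel B r P) (j : ℕ+) :
    Tendsto (fun n : ℕ => P {ω | D.volume n ω = j}) atTop (𝓝 (B.stationaryLaw r j)) := by
  have hc : (0 : ℝ) < B.lam0 + B.muA := by exact_mod_cast hB
  have hν : ∑' i, P {ω | D.initial ω = i} = 1 := by
    have h := tsum_measure_preimage_singleton (μ := P) (f := D.initial) (s := univ)
      countable_univ fun i _ => hD.measurable_initial (measurableSet_singleton i)
    rw [tsum_univ (f := fun i => P (D.initial ⁻¹' {i}))] at h
    exact h.trans (by simp)
  have h1 : Tendsto (fun n : ℕ => ENNReal.ofReal (Real.exp (-((B.lam0 + B.muA) * (n : ℝ≥0)))) *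
      mixture r (fun i => P {ω | D.initial ω = i}) j n) atTop (𝓝 0) := by
    have h0 : Tendsto (fun n : ℕ => ENNReal.ofReal (Real.exp (-((B.lam0 + B.muA) * (n : ℝ≥0)))))
        atTop (𝓝 0) := by
      rw [← ENNReal.ofReal_zero]
      refine ENNReal.tendsto_ofReal (Real.tendsto_exp_neg_atTop_nhds_zero.comp ?_)
      simpa using tendsto_natCast_atTop_atTop.const_mul_atTop hc
    refine tendsto_of_tendsto_of_tendsto_of_le_of_le tendsto_const_nhds h0 (fun _ => zero_le)
      fun n => ?_
    exact mul_le_of_le_one_right' ((hr.mixture_le _ j n).trans hν.le)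
  have h2 : Tendsto (fun n : ℕ => ∫⁻ u in Ico (0 : ℝ) (n : ℝ≥0),
      B.moveDensity u * mixture r B.resetLaw j u.toNNReal) atTop (𝓝 (B.stationaryLaw r j)) := by
    have hmono : Monotone fun n : ℕ => Ico (0 : ℝ) (n : ℝ≥0) := fun n k h =>
      Ico_subset_Ico_right (by exact_mod_cast h)
    have hU : ⋃ n : ℕ, Ico (0 : ℝ) (n : ℝ≥0) = Ici 0 := by
      ext u
      simp only [mem_iUnion, mem_Ico, mem_Ici, NNReal.coe_natCast]
      exact ⟨fun ⟨_, h, _⟩ => h, fun h => (exists_nat_gt u).imp fun n hn => ⟨h, hn⟩⟩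
    have h := tendsto_measure_iUnion_atTop
      -- The integrals over `[0, n)` are masses of increasing sets, so continuity from below gives
      -- the limit.
      (μ := (MeasureTheory.volume : Measure ℝ).withDensity fun u =>
        B.moveDensity u * mixture r B.resetLaw j u.toNNReal) hmono
    rw [hU, withDensity_apply _ measurableSet_Ici] at h
    simpa only [Function.comp_def, withDensity_apply _ measurableSet_Ico, Params.stationaryLaw] using h
  have h3 := h1.add h2
  rw [zero_add] at h3
  exact h3.congr fun n => (hD.measure_volume_eq hB hr n j).symm

theorem Inputs.IsModel.stationary_iff (hB : 0 < B.lam0 + B.muA)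
    (hr : IsTransitionFunction Q r) (hD : D.IsModel B r P) :
    (∀ (t : ℝ≥0) (j : ℕ+), P {ω | D.volume t ω = j} = P {ω | D.volume 0 ω = j}) ↔
      ∀ j : ℕ+, P {ω | D.volume 0 ω = j} = B.stationaryLaw r j := by
  refine ⟨fun h j => ?_, fun h t j => ?_⟩
  -- A constant law equals its own limit, which is `π`.
  · refine tendsto_nhds_unique ?_ (hD.tendsto_measure_volume hB hr j)
    simp_rw [h]
    exact tendsto_const_nhds
  · have hν : (fun i => P {ω | D.initial ω = i}) = B.stationaryLaw r := by
      ext i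
      rw [← h, hD.measure_volume_zero hB hr]
    -- Started from `π`, the no-move term is the integral over ages in `[t, ∞)` and completes the
    -- one over `[0, t)`.
    rw [hD.measure_volume_eq hB hr, h, hν, ← Params.lintegral_Ici_moveDensity hr, add_comm,
      ← lintegral_union measurableSet_Ici (Set.disjoint_left.2 fun u hu hu' =>
        not_lt.2 hu' hu.2), Ico_union_Ici_eq_Ici t.coe_nonneg, Params.stationaryLaw]

end Stationary
end OrderBook

theorem mainTheorem1 (B : OrderBook.Params) (hB : 0 < B.lam0 + B.muA)
    (r : ℝ≥0 → ℕ → ℕ → ℝ) (hr : OrderBook.IsTransitionFunction B.generator r) :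
    -- the series `f_j` converge and have a Laplace transform at `λ₀ + μ_A`
    (∀ (j : ℕ+) (t : ℝ),
      Summable fun i : ℕ+ => B.h i * OrderBook.shiftedTransition r t.toNNReal i j) ∧
    (∀ j : ℕ+, IntegrableOn
      (fun t : ℝ => Real.exp (-((B.lam0 + B.muA : ℝ) * t)) * B.f r j t) (Ioi 0)) ∧
    -- `π` is a probability distribution
    (∀ j : ℕ+, 0 ≤ B.stationary r j) ∧
    HasSum (B.stationary r) 1 ∧
    -- in every realization of the model
    ∀ (Ω : Type*) [MeasurableSpace Ω] (P : Measure Ω) [IsProbabilityMeasure P]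
      (D : OrderBook.Inputs Ω), D.IsModel B r P →
      -- the price moves (killings and resurrections) form a Poisson process of rate `λ₀ + μ_A`
      OrderBook.IsPoissonProcess (B.lam0 + B.muA) D.priceMoves P ∧
      -- the volumes at the best quote are random variables
      (∀ t, Measurable (D.volume t)) ∧
      -- the law of the volume is constant in time if and only if the initial volume has law `π`
      ((∀ (t : ℝ≥0) (j : ℕ+),
          P.real {ω | D.volume t ω = j} = P.real {ω | D.volume 0 ω = j}) ↔
        ∀ j : ℕ+, P.real {ω | D.volume 0 ω = j} = B.stationary r j) := by
  refine ⟨fun j t => OrderBook.Params.summable_f hB hr j _,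
    OrderBook.Params.integrableOn_laplace hB hr, OrderBook.Params.stationary_nonneg hr,
    OrderBook.Params.hasSum_stationary hB hr, fun Ω _ P _ D hD =>
    ⟨hD.isPoissonProcess_priceMoves, hD.measurable_volume, ?_⟩⟩
  refine Iff.trans (forall₂_congr fun t j => ?_)
    ((hD.stationary_iff hB hr).trans (forall_congr' fun j => ?_))
  · exact measureReal_eq_measureReal_iff
  · rw [← OrderBook.Params.ofReal_stationary hB hr, ← ofReal_measureReal,
      ENNReal.ofReal_eq_ofReal_iff measureReal_nonneg (OrderBook.Params.stationary_nonneg hr j)]
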